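/- Let $Z$ be an $\mathbb{N}$-valued offspring variable with $p_k=\mathbf P[Z=k]$, $\mathbf E[Z]=1$, $\mathbf P[Z=1]<1$ and $\mathbf E[Z^2]<\infty$, and let $\tilde Z$ be its size-biased version, $\mathbf P[\tilde Z=k]=k\,p_k$. The incipient infinite critical Galton-Watson tree (IICGW) is the two-type Galton-Watson tree whose root is of type $A$, in which every vertex of type $A$ has exactly one child of type $A$ and a number of children of type $B$ distributed as $\tilde Z-1$, and every vertex of type $B$ has a number of children, all of type $B$, distributed as $Z$ (all these numbers being independent). The bi-infinite tree (IBICGW) is obtained from two independent IICGWs by joining their roots by an edge; its root is the root of the first one. Its type $A$ vertices form the backbone, indexed by $\mathbb Z$ so that the root has index $0$, the type $A$ vertices of the first tree have indices $0,1,2,\dots$ in order of their generation, and those of the second tree have indices $-1,-2,\dots$. The bi-infinite incipient critical branching random walk in $\mathbb Z^d$, with law $\mathbf P^{-\infty,\infty}$, is obtained by attaching independently to each edge of the IBICGW a jump of the simple random walk on $\mathbb Z^d$ (uniform on the $2d$ unit vectors), the edges being oriented away from the root, and by placing each vertex at the sum of the jumps along the path from the root to it (so the root is at $0$). Let $\alpha(n)$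 be the position of the $n$-th backbone vertex, so that $\alpha(0)=0$, and let $\mathcal B^{(n)}(\alpha(n))\subset\mathbb Z^d$ be the set of positions of the $n$-th backbone vertex and of all vertices of type $B$ that descend from it through type $B$ vertices only. For $A\subset\mathbb Z$ put $\mathcal B(\alpha(A))=\bigcup_{n\in A}\mathcal B^{(n)}(\alpha(n))$. The point $\alpha(i)$ is called pivotal if $$\mathcal B(\alpha((-\infty,i]))\cap\mathcal B(\alpha([i+1,\infty)))=\emptyset .$$ **Lemma.** If $d>10$, then $$\mathbf P^{-\infty,\infty}[\,0\text{ is a pivotal point}\,]=\mathbf P^{-\infty,\infty}\bigl[\mathcal B(\alpha((-\infty,0]))\cap\mathcal B(\alpha([1,\infty)))=\emptyset\bigr]>0 .$$ -/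

import Mathlib

open MeasureTheory

noncomputable section

namespace CriticalBRW

/-- The offspring law `p` (with `p k = P[Z = k]`) is critical: `E[Z] = 1`. -/
def IsCritical (p : PMF ℕ) : Prop := ∑' k : ℕ, (k : ENNReal) * p k = 1

/-- The offspring law `p` has a finite second moment: `E[Z ^ 2] < ∞`. -/
def HasFiniteSecondMoment (p : PMF ℕ) : Prop := ∑' k : ℕ, (k : ENNReal) ^ 2 * p k < ⊤

/-- The size-biased law `P[Z̃ = k] = k * p k` of a critical offspring law. -/
def sizeBiased (p : PMF ℕ) (hp : IsCritical p) : PMF ℕ :=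
  ⟨fun k => (k : ENNReal) * p k, by
    have h : ∑' k : ℕ, (k : ENNReal) * p k = 1 := hp
    exact h ▸ ENNReal.summable.hasSum⟩

/-- Labels of the vertices of a tree with a backbone indexed by `ι`. The label `(n, [])` is the
`n`-th backbone vertex; `(n, j :: u)` is the `j`-th child (counted from `0`) of `(n, u)` in the
bush that hangs off the `n`-th backbone vertex. -/
abbrev Label (ι : Type) : Type := ι × List ℕ

/-- Law of the number of off-backbone (type `B`) children of a vertex: `Z̃ - 1` for a backbone
(type `A`) vertex, `Z` for a type `B` vertex. -/
def offspringLaw (p : PMF ℕ) (hp : IsCritical p) : List ℕ → PMF ℕ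
  | [] => (sizeBiased p hp).map (fun k => k - 1)
  | _ :: _ => p

/-- The incipient infinite critical Galton-Watson tree (IICGW), as the law of the independent
numbers of type `B` children of all labels. The backbone vertex `(k, [])`, `k : ℕ`, has exactly
one type `A` child, namely `(k + 1, [])`, and the root is `(0, [])`. -/
def iicgw (p : PMF ℕ) (hp : IsCritical p) : Measure (Label ℕ → ℕ) :=
  Measure.infinitePi (fun v : Label ℕ => (offspringLaw p hp v.2).toMeasure)

/-- Join two trees, each with a one-sided backbone, by an edge between their roots. The backbone
vertex `k` of the first tree becomes the vertex `k` of the bi-infinite backbone, the backbone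
vertex `k` of the second one becomes the vertex `-(k + 1)`. -/
def joinTrees (t : (Label ℕ → ℕ) × (Label ℕ → ℕ)) : Label ℤ → ℕ
  | (Int.ofNat k, u) => t.1 (k, u)
  | (Int.negSucc k, u) => t.2 (k, u)

/-- The incipient bi-infinite critical Galton-Watson tree (IBICGW): two independent IICGWs with
their roots joined by an edge, rooted at the root `(0, [])` of the first one. -/
def ibicgw (p : PMF ℕ) (hp : IsCritical p) : Measure (Label ℤ → ℕ) :=
  ((iicgw p hp).prod (iicgw p hp)).map joinTrees

/-- `InTree ξ n u`: the label `(n, u)` is a vertex of the tree with offspring numbers `ξ`. -/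
def InTree (ξ : Label ℤ → ℕ) (n : ℤ) : List ℕ → Prop
  | [] => True
  | j :: u => InTree ξ n u ∧ j < ξ (n, u)

/-- The unit vector `e_i` or `-e_i` of `ℤ ^ d`. -/
def unitVector (d : ℕ) (s : Fin d × Bool) : Fin d → ℤ :=
  Pi.single s.1 (if s.2 then 1 else -1)

/-- Jump law of the simple random walk on `ℤ ^ d`: uniform on the `2 * d` unit vectors. -/
def srwStep (d : ℕ) [NeZero d] : PMF (Fin d → ℤ) :=
  (PMF.uniformOfFintype (Fin d × Bool)).map (unitVector d)

/-- Independent simple random walk jumps. The jump `X v` belongs to the edge from the parent of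
`v` (its neighbour in the direction of the root `(0, [])`) to `v`; the root has no such edge and
`X (0, [])` is never used. -/
def jumpLaw (d : ℕ) [NeZero d] : Measure (Label ℤ → Fin d → ℤ) :=
  Measure.infinitePi (fun _ : Label ℤ => (srwStep d).toMeasure)

/-- A sample: offspring numbers and jumps. -/
abbrev Sample (d : ℕ) : Type := (Label ℤ → ℕ) × (Label ℤ → Fin d → ℤ)

/-- The law `P^{-∞,∞}` of the incipient bi-infinite critical branching random walk (IBICBRW):
the IBICGW with the simple random walk embedding. -/
def ibicbrw (p : PMF ℕ) (hp : IsCritical p) (d : ℕ) [NeZero d] : Measure (Sample d) :=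
  (ibicgw p hp).prod (jumpLaw d)

/-- Position `α n` of the `n`-th backbone vertex: the sum of the jumps along the backbone between
`0` and `n`. At most one of the two sums is non-empty, and `α 0 = 0`. -/
def backbone {d : ℕ} (X : Label ℤ → Fin d → ℤ) (n : ℤ) : Fin d → ℤ :=
  ∑ k ∈ Finset.Icc 1 n, X (k, []) + ∑ k ∈ Finset.Icc n (-1), X (k, [])

/-- Position of the vertex `(n, u)`: the sum of the jumps along the path from the root to it. -/
def position {d : ℕ} (X : Label ℤ → Fin d → ℤ) (n : ℤ) : List ℕ → Fin d → ℤ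
  | [] => backbone X n
  | j :: u => position X n u + X (n, j :: u)

/-- The set `𝓑^{(n)}(α n)` of sites visited by the `n`-th bush (with `α n` itself). -/
def bush {d : ℕ} (ω : Sample d) (n : ℤ) : Set (Fin d → ℤ) :=
  {x | ∃ u : List ℕ, InTree ω.1 n u ∧ position ω.2 n u = x}

/-- The set `𝓑(α(A))`, the union of the bushes with index in `A`. -/
def bushes {d : ℕ} (ω : Sample d) (A : Set ℤ) : Set (Fin d → ℤ) :=
  ⋃ n ∈ A, bush ω n

/-- `α i` is a pivotal point: `𝓑(α((-∞, i]))` and `𝓑(α([i + 1, ∞)))` do not intersect. -/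
def IsPivotal {d : ℕ} (ω : Sample d) (i : ℤ) : Prop :=
  bushes ω (Set.Iic i) ∩ bushes ω (Set.Ici (i + 1)) = ∅

end CriticalBRW

end

/-! Positivity need only be shown after conditioning on an event of positive probability that fixes
finitely many offspring numbers and jumps. Choose `r` in the support of Z̃ - 1. For every backbone
index in [-N, N], prescribe exactly `r` type B children, all childless; let the two halves of the
backbone run straight in opposite directions along an axis `a`, and let the bush edges of this core
be parallel to another axis `b`. The conditioned law is absolutely continuous with respect to the
original one (`prod_coreOffspring_coreStep_absolutelyContinuous`), so it is enough that it gives a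
collision probability below 1 for some `N`.

That probability is estimated by a union bound over pairs of vertices, one on each side
(`measure_not_isPivotal_le`). If the two paths to a pair have `t` edges outside the core in total,
the pair meets with probability O((t+1)^(-11/2)), by the local bound `walkCount_div_sq_le` and
`infinitePi_sum_le`. Since the core pulls the two sides apart, a meeting forces t ≥ N
(`le_freeCount_add_freeCount`).

The exponent splits as 11/2 = 1/2 + 4 · 5/4. Each vertex receives two factors with exponent 5/4, one
summable over the backbone index and one over the generation; generations have bounded mean size,
because type B vertices have mean offspring 1 and E[Z̃ - 1] ≤ E[Z²]. The sum over each vertex is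
thus bounded uniformly in `N` (`tsum_reach_mul_weight_le`), and the remaining N^(-1/2) tends to 0.
-/

namespace CriticalBRW

/-! ### Local upper bound for simple random walk, by counting paths. -/

open AddMonoidAlgebra in
/-- Generating function of one step along the `i`-th axis, with unnormalised weights. -/
noncomputable def axisStep (d : ℕ) (i : Fin d) : AddMonoidAlgebra ℕ (Fin d → ℤ) :=
  single (unitVector d (i, true)) 1 + single (unitVector d (i, false)) 1

lemma coeff_mul_axisStep_pow {d : ℕ} (i : Fin d) (n : ℕ)
    (P : AddMonoidAlgebra ℕ (Fin d → ℤ)) (x : Fin d → ℤ) :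
    (P * axisStep d i ^ n).coeff x = ∑ j ∈ Finset.range (n + 1),
      P.coeff (x - Pi.single i ((2 * j - n : ℤ))) * n.choose j := by
  rw [axisStep, add_pow, Finset.mul_sum, AddMonoidAlgebra.coeff_sum, Finsupp.finsetSum_apply]
  refine Finset.sum_congr rfl fun j hj => ?_
  have hj' : j ≤ n := by simpa [Nat.lt_succ_iff] using hj
  rw [AddMonoidAlgebra.single_pow, AddMonoidAlgebra.single_pow,
    AddMonoidAlgebra.single_mul_single, mul_comm _ (n.choose j : AddMonoidAlgebra ℕ (Fin d → ℤ)),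
    AddMonoidAlgebra.natCast_def, AddMonoidAlgebra.single_mul_single,
    AddMonoidAlgebra.coeff_mul_single_apply]
  have : (0 + (j • unitVector d (i, true) + (n - j) • unitVector d (i, false)))
      = (Pi.single i ((2 * j - n : ℤ)) : Fin d → ℤ) := by
    ext l
    rcases eq_or_ne l i with rfl | h
    · simp [unitVector, hj']; ring
    · simp [unitVector, h]
  rw [this, ← sub_eq_add_neg]
  simp

/-- The coordinate `x a` determines how many of the `n a` steps are positive, so one binomial
coefficient at most survives for each axis. The vanishing statement is what makes the other terms
drop out in the induction. -/
lemma coeff_prod_axisStep_pow_le {d : ℕ} (n : Fin d → ℕ) (T : Finset (Fin d)) (x : Fin d → ℤ) :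
    (∏ i ∈ T, axisStep d i ^ n i).coeff x ≤ ∏ i ∈ T, (n i).choose (n i / 2) ∧
      ((∃ i ∉ T, x i ≠ 0) → (∏ i ∈ T, axisStep d i ^ n i).coeff x = 0) := by
  induction T using Finset.induction_on generalizing x with
  | empty =>
    simp only [Finset.prod_empty, AddMonoidAlgebra.one_def, AddMonoidAlgebra.coeff_single]
    refine ⟨?_, ?_⟩
    · rw [Finsupp.single_apply]; split_ifs <;> simp
    · rintro ⟨i, -, hi⟩
      rw [Finsupp.single_apply, if_neg]
      rintro rfl
      exact hi rfl
  | insert a T ha ih =>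
    rw [Finset.prod_insert ha, Finset.prod_insert ha, mul_comm, coeff_mul_axisStep_pow]
    constructor
    · by_cases h : ∃ j ∈ Finset.range (n a + 1), x a = 2 * j - n a
      · obtain ⟨j, hj, hx⟩ := h
        rw [Finset.sum_eq_single_of_mem j hj, mul_comm]
        · exact Nat.mul_le_mul (Nat.choose_le_middle _ _) (ih _).1
        · intro b _ hb
          rw [(ih _).2, zero_mul]
          refine ⟨a, ha, ?_⟩
          simp only [Pi.sub_apply, Pi.single_eq_same]
          omega
      · rw [Finset.sum_eq_zero]
        · exact Nat.zero_le _
        · intro b hb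
          rw [(ih _).2, zero_mul]
          refine ⟨a, ha, ?_⟩
          simp only [Pi.sub_apply, Pi.single_eq_same]
          intro h'
          exact h ⟨b, hb, by linarith⟩
    · rintro ⟨i, hi, hx⟩
      simp only [Finset.mem_insert, not_or] at hi
      refine Finset.sum_eq_zero fun b _ => ?_
      rw [(ih _).2, zero_mul]
      refine ⟨i, hi.2, ?_⟩
      simpa [hi.1] using hx

/-- Number of simple random walk paths with `k` steps from `0` to `x`. -/
noncomputable def walkCount (d k : ℕ) (x : Fin d → ℤ) : ℕ := ((∑ i, axisStep d i) ^ k).coeff x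

lemma walkCount_zero (d : ℕ) (x : Fin d → ℤ) : walkCount d 0 x = if x = 0 then 1 else 0 := by
  simp [walkCount, AddMonoidAlgebra.one_def, Finsupp.single_apply, eq_comm]

lemma walkCount_succ (d k : ℕ) (x : Fin d → ℤ) :
    walkCount d (k + 1) x = ∑ s : Fin d × Bool, walkCount d k (x - unitVector d s) := by
  rw [walkCount, pow_succ, Finset.mul_sum, AddMonoidAlgebra.coeff_sum, Finsupp.finsetSum_apply,
    Fintype.sum_prod_type]
  refine Finset.sum_congr rfl fun i _ => ?_
  simp [axisStep, mul_add, walkCount, AddMonoidAlgebra.coeff_mul_single_apply, sub_eq_add_neg]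

/-- The multinomial theorem groups the paths by the number of steps taken along each axis. -/
lemma walkCount_le (d k : ℕ) (x : Fin d → ℤ) :
    walkCount d k x ≤ ∑ n ∈ Finset.piAntidiag (Finset.univ : Finset (Fin d)) k,
      Nat.multinomial Finset.univ n * ∏ i, (n i).choose (n i / 2) := by
  rw [walkCount, Finset.sum_pow_eq_sum_piAntidiag, AddMonoidAlgebra.coeff_sum,
    Finsupp.finsetSum_apply]
  refine Finset.sum_le_sum fun n _ => ?_
  rw [AddMonoidAlgebra.natCast_def, ← zero_add x, AddMonoidAlgebra.coeff_single_zero_mul]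
  exact Nat.mul_le_mul le_rfl ((coeff_prod_axisStep_pow_le n _ _).1.trans_eq rfl)

lemma centralBinom_sq_mul_le (m : ℕ) : m.centralBinom ^ 2 * (2 * m + 1) ≤ 16 ^ m := by
  induction m with
  | zero => simp
  | succ m ih =>
    have h := Nat.succ_mul_centralBinom_succ m
    have h2 : (m + 1) ^ 2 * ((m + 1).centralBinom ^ 2 * (2 * (m + 1) + 1))
        ≤ (m + 1) ^ 2 * 16 ^ (m + 1) := by
      calc (m + 1) ^ 2 * ((m + 1).centralBinom ^ 2 * (2 * (m + 1) + 1))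
          = ((m + 1) * (m + 1).centralBinom) ^ 2 * (2 * m + 3) := by ring
        _ = 4 * (2 * m + 1) * (2 * m + 3) * (m.centralBinom ^ 2 * (2 * m + 1)) := by
          rw [h]; ring
        _ ≤ (16 * (m + 1) ^ 2) * 16 ^ m := Nat.mul_le_mul (by nlinarith) ih
        _ = _ := by ring
    exact Nat.le_of_mul_le_mul_left h2 (by positivity)

lemma choose_half_sq_mul_le (n : ℕ) : n.choose (n / 2) ^ 2 * (n + 1) ≤ 4 ^ n := by
  obtain ⟨m, rfl | rfl⟩ := Nat.even_or_odd' n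
  · have := centralBinom_sq_mul_le m
    rw [show 2 * m / 2 = m by omega, pow_mul]
    simpa [Nat.centralBinom] using this
  · have := centralBinom_sq_mul_le (m + 1)
    have h : (m + 1).centralBinom = 2 * (2 * m + 1).choose m := by
      rw [Nat.centralBinom_eq_two_mul_choose, show 2 * (m + 1) = (2 * m + 1) + 1 by ring,
        Nat.choose_succ_succ, Nat.choose_symm_half]
      ring
    rw [h] at this
    rw [show (2 * m + 1) / 2 = m by omega]
    have h4 : (4 : ℕ) ^ (2 * m + 1) * 4 = 16 ^ (m + 1) := by
      rw [← pow_succ, show 2 * m + 1 + 1 = 2 * (m + 1) by ring, pow_mul]; norm_num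
    nlinarith [Nat.zero_le ((2 * m + 1).choose m ^ 2)]

/-- Dividing by the product of the `n i + 1` turns the multinomial coefficient of `n` into that of
`n + 1`, up to the factor k!/(k+d)!. The shifted coefficients are some of the terms in the expansion
of d^(k+d). -/
lemma sum_multinomial_div_le (d k : ℕ) :
    ∑ n ∈ Finset.piAntidiag (Finset.univ : Finset (Fin d)) k,
      (Nat.multinomial Finset.univ n : ℝ) / ∏ i, ((n i : ℝ) + 1) ≤
        d ^ (k + d) / (k + 1) ^ d := by
  have h1 : ∀ n ∈ Finset.piAntidiag (Finset.univ : Finset (Fin d)) k,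
      (Nat.multinomial Finset.univ n : ℝ) / ∏ i, ((n i : ℝ) + 1) =
        (k.factorial : ℝ) / (k + d).factorial *
          Nat.multinomial Finset.univ (fun i => n i + 1) := by
    intro n hn
    have hs : ∑ i, n i = k := (Finset.mem_piAntidiag.1 hn).1
    have e1 := Nat.multinomial_spec Finset.univ n
    have e2 := Nat.multinomial_spec Finset.univ (fun i => n i + 1)
    rw [Finset.sum_add_distrib, hs] at e2
    rw [hs] at e1
    simp only [Finset.sum_const, Finset.card_univ, Fintype.card_fin, smul_eq_mul, mul_one,
      Nat.factorial_succ, Finset.prod_mul_distrib] at e2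
    rw [← e1, ← e2]
    have p1 : ((∏ i, (n i).factorial : ℕ) : ℝ) ≠ 0 := by
      exact_mod_cast Finset.prod_ne_zero_iff.2 fun i _ => Nat.factorial_ne_zero _
    have p2 : (∏ i, ((n i : ℝ) + 1)) ≠ 0 :=
      Finset.prod_ne_zero_iff.2 fun i _ => by positivity
    have p3 : (Nat.multinomial Finset.univ (fun i => n i + 1) : ℝ) ≠ 0 := by
      exact_mod_cast (Nat.multinomial_pos _ _).ne'
    push_cast at p1 ⊢
    field_simp
  rw [Finset.sum_congr rfl h1, ← Finset.mul_sum]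
  have h2 : (∑ n ∈ Finset.piAntidiag (Finset.univ : Finset (Fin d)) k,
      (Nat.multinomial Finset.univ (fun i => n i + 1) : ℝ)) ≤ d ^ (k + d) := by
    have h3 := Finset.sum_pow_eq_sum_piAntidiag (Finset.univ : Finset (Fin d))
      (fun _ => (1 : ℝ)) (k + d)
    simp only [Finset.sum_const, Finset.card_univ, Fintype.card_fin, nsmul_eq_mul, mul_one,
      one_pow, Finset.prod_const_one] at h3
    rw [h3, ← Finset.sum_image (s := Finset.piAntidiag (Finset.univ : Finset (Fin d)) k)
      (g := fun n i => n i + 1) (f := fun n => (Nat.multinomial Finset.univ n : ℝ))]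
    · refine Finset.sum_le_sum_of_subset_of_nonneg ?_ fun _ _ _ => Nat.cast_nonneg _
      intro m hm
      obtain ⟨n, hn, rfl⟩ := Finset.mem_image.1 hm
      rw [Finset.mem_piAntidiag] at hn ⊢
      refine ⟨?_, fun _ _ => Finset.mem_univ _⟩
      rw [Finset.sum_add_distrib, hn.1]
      simp
    · intro n _ m _ h
      ext i
      have := congrFun h i
      simpa using this
  have h4 : ((k + 1 : ℝ)) ^ d * k.factorial ≤ (k + d).factorial := by
    have := Nat.pow_succ_le_ascFactorial (k + 1) d
    have e := Nat.factorial_mul_ascFactorial k d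
    rw [← e]
    push_cast
    rw [mul_comm]
    have : ((k + 1 : ℝ)) ^ d ≤ ((k + 1).ascFactorial d : ℝ) := by exact_mod_cast this
    gcongr
  have h5 : (k.factorial : ℝ) / (k + d).factorial ≤ 1 / (k + 1) ^ d := by
    rw [div_le_div_iff₀ (by positivity) (by positivity)]
    linarith
  calc _ ≤ (1 / (k + 1) ^ d : ℝ) * d ^ (k + d) := by gcongr
    _ = _ := by ring

/-- The `k`-step transition probabilities of the simple random walk on `ℤ ^ d` are at most
`(d / (k + 1)) ^ (d / 2)`. -/
lemma walkCount_div_sq_le (d : ℕ) [NeZero d] (k : ℕ) (x : Fin d → ℤ) :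
    ((walkCount d k x : ℝ) / (2 * d) ^ k) ^ 2 ≤ d ^ d / (k + 1) ^ d := by
  have hd : (0 : ℝ) < d := by exact_mod_cast Nat.pos_of_ne_zero (NeZero.ne d)
  have h1 : (walkCount d k x : ℝ) ≤ ∑ n ∈ Finset.piAntidiag (Finset.univ : Finset (Fin d)) k,
      (Nat.multinomial Finset.univ n : ℝ) * ∏ i, ((n i).choose (n i / 2) : ℝ) := by
    exact_mod_cast walkCount_le d k x
  set f : (Fin d → ℕ) → ℝ := fun n => (Nat.multinomial Finset.univ n : ℝ)
  set g : (Fin d → ℕ) → ℝ := fun n =>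
    (Nat.multinomial Finset.univ n : ℝ) * ∏ i, ((n i).choose (n i / 2) : ℝ) ^ 2
  -- Cauchy–Schwarz with multinomial weights: squaring the central binomials replaces the factors (n
  -- i + 1)^(-1/2) by (n i + 1)^(-1), for which the sum is controlled by `sum_multinomial_div_le`.
  have h2 := Finset.sum_sq_le_sum_mul_sum_of_sq_le_mul
    (Finset.piAntidiag (Finset.univ : Finset (Fin d)) k)
    (r := fun n => (Nat.multinomial Finset.univ n : ℝ) * ∏ i, ((n i).choose (n i / 2) : ℝ))
    (f := f) (g := g) (fun _ _ => by positivity) (fun _ _ => by positivity)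
    (fun n _ => by simp only [f, g, Finset.prod_pow]; exact (by ring : _ = _).le)
  have h3 : ∑ n ∈ Finset.piAntidiag (Finset.univ : Finset (Fin d)) k, f n = d ^ k := by
    have h3 := Finset.sum_pow_eq_sum_piAntidiag (Finset.univ : Finset (Fin d))
      (fun _ => (1 : ℝ)) k
    simp only [Finset.sum_const, Finset.card_univ, Fintype.card_fin, nsmul_eq_mul, mul_one,
      one_pow, Finset.prod_const_one] at h3
    exact h3.symm
  have h4 : ∑ n ∈ Finset.piAntidiag (Finset.univ : Finset (Fin d)) k, g n ≤
      4 ^ k * (d ^ (k + d) / (k + 1) ^ d) := by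
    refine le_trans ?_ (mul_le_mul_of_nonneg_left (sum_multinomial_div_le d k) (by positivity))
    rw [Finset.mul_sum]
    refine Finset.sum_le_sum fun n hn => ?_
    have hs : ∑ i, n i = k := (Finset.mem_piAntidiag.1 hn).1
    have : ∏ i, ((n i).choose (n i / 2) : ℝ) ^ 2 ≤ ∏ i, (4 ^ (n i) / ((n i : ℝ) + 1)) := by
      refine Finset.prod_le_prod (fun _ _ => by positivity) fun i _ => ?_
      rw [le_div_iff₀ (by positivity)]
      exact_mod_cast choose_half_sq_mul_le (n i)
    rw [Finset.prod_div_distrib, Finset.prod_pow_eq_pow_sum, hs] at this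
    calc g n ≤ (Nat.multinomial Finset.univ n : ℝ) * (4 ^ k / ∏ i, ((n i : ℝ) + 1)) := by
          simp only [g]; gcongr
      _ = _ := by ring
  rw [div_pow, div_le_iff₀ (by positivity)]
  calc (walkCount d k x : ℝ) ^ 2 ≤ _ := by gcongr
    _ ≤ _ := h2
    _ ≤ d ^ k * (4 ^ k * (d ^ (k + d) / (k + 1) ^ d)) := by rw [h3]; gcongr
    _ = _ := by
      rw [mul_pow, mul_pow, pow_add, show (4 : ℝ) = 2 ^ 2 by norm_num, ← pow_mul, ← pow_mul,
        ← pow_mul]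
      ring

/-! ### Conditioning a product measure on finitely many coordinates. -/

section Pinned

variable {ι : Type*} [DecidableEq ι] {α : ι → Type*} [∀ i, MeasurableSpace (α i)]

/-- The family `μ` of laws, with the coordinates in `F` made deterministic, equal to `c`. -/
noncomputable def pinned (μ : ∀ i, Measure (α i)) (F : Finset ι) (c : ∀ i, α i) (i : ι) :
    Measure (α i) :=
  if i ∈ F then Measure.dirac (c i) else μ i

lemma pinned_of_mem (μ : ∀ i, Measure (α i)) {F : Finset ι} (c : ∀ i, α i) {i : ι} (hi : i ∈ F) :
    pinned μ F c i = Measure.dirac (c i) := if_pos hi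

lemma pinned_of_notMem (μ : ∀ i, Measure (α i)) {F : Finset ι} (c : ∀ i, α i) {i : ι}
    (hi : i ∉ F) : pinned μ F c i = μ i := if_neg hi

variable (μ : ∀ i, Measure (α i)) [∀ i, IsProbabilityMeasure (μ i)]

instance (F : Finset ι) (c : ∀ i, α i) (i : ι) : IsProbabilityMeasure (pinned μ F c i) := by
  unfold pinned; split_ifs <;> infer_instance

/-- The pinned product is the original product conditioned on the cylinder event `E` that the
coordinates in `F` equal `c`, an event of probability `K > 0`. -/
lemma infinitePi_pinned_absolutelyContinuous [∀ i, MeasurableSingletonClass (α i)] (F : Finset ι)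
    (c : ∀ i, α i) (hc : ∀ i ∈ F, μ i {c i} ≠ 0) :
    Measure.infinitePi (pinned μ F c) ≪ Measure.infinitePi μ := by
  set K := ∏ i ∈ F, μ i {c i} with hK
  have hK0 : K ≠ 0 := Finset.prod_ne_zero_iff.2 hc
  have hKt : K ≠ ⊤ := ENNReal.prod_ne_top fun i _ => measure_ne_top _ _
  set E : Set (∀ i, α i) := Set.pi F (fun i => {c i})
  have hE : MeasurableSet E := MeasurableSet.pi F.countable_toSet fun _ _ => measurableSet_singleton _
  have key : K⁻¹ • (Measure.infinitePi μ).restrict E = Measure.infinitePi (pinned μ F c) := by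
    refine Measure.eq_infinitePi _ fun s t ht => ?_
    have hst : MeasurableSet (Set.pi (s : Set ι) t) :=
      MeasurableSet.pi s.countable_toSet fun i _ => ht i
    have hbox : Set.pi (s : Set ι) t ∩ E = Set.pi (↑(s ∪ F) : Set ι) (fun i =>
        (if i ∈ s then t i else Set.univ) ∩ (if i ∈ F then {c i} else Set.univ)) := by
      ext x
      simp only [E, Set.mem_inter_iff, Set.mem_pi, Finset.coe_union, Set.mem_union,
        Finset.mem_coe]
      constructor
      · rintro ⟨h1, h2⟩ i -
        refine ⟨?_, ?_⟩ <;> split_ifs with h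
        exacts [h1 i h, trivial, h2 i h, trivial]
      · intro h
        refine ⟨fun i hi => ?_, fun i hi => ?_⟩
        · simpa [hi] using (h i (Or.inl hi)).1
        · simpa [hi] using (h i (Or.inr hi)).2
    rw [Measure.smul_apply, Measure.restrict_apply hst, hbox, Measure.infinitePi_pi, smul_eq_mul]
    · have e1 : K = ∏ i ∈ s ∪ F, if i ∈ F then μ i {c i} else 1 := by
        rw [hK, Finset.prod_ite_mem, Finset.union_inter_cancel_right]
      have e2 : ∏ i ∈ s, pinned μ F c i (t i)
          = ∏ i ∈ s ∪ F, if i ∈ s then pinned μ F c i (t i) else 1 := by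
        rw [Finset.prod_ite_mem, Finset.union_inter_cancel_left]
      rw [e2, ← ENNReal.div_eq_inv_mul, eq_comm, ENNReal.eq_div_iff hK0 hKt, e1, ← Finset.prod_mul_distrib]
      refine Finset.prod_congr rfl fun i hi => ?_
      by_cases hF : i ∈ F
      · by_cases hs : i ∈ s
        · simp only [hF, hs, if_true, pinned_of_mem, Measure.dirac_apply' _ (ht i)]
          by_cases hct : c i ∈ t i
          · rw [Set.inter_eq_right.2 (by simpa using hct)]; simp [hct]
          · rw [Set.inter_singleton_eq_empty.2 hct]; simp [hct]
        · simp [hF, hs]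
      · have hs : i ∈ s := by simpa [hF] using hi
        simp [hF, hs, pinned_of_notMem]
    · intro i _
      refine MeasurableSet.inter ?_ ?_ <;> split_ifs
      exacts [ht i, MeasurableSet.univ, measurableSet_singleton _, MeasurableSet.univ]
  rw [← key]
  exact (Measure.restrict_le_self.absolutelyContinuous).smul_left _

end Pinned

instance (p : PMF ℕ) (hp : IsCritical p) : IsProbabilityMeasure (iicgw p hp) := by
  unfold iicgw; infer_instance

/-- Joining two independent trees only relabels the coordinates, so the result is again a product
measure and can be pinned. -/
lemma ibicgw_eq_infinitePi (p : PMF ℕ) (hp : IsCritical p) :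
    ibicgw p hp = Measure.infinitePi (fun v : Label ℤ => (offspringLaw p hp v.2).toMeasure) := by
  have hmeas : Measurable joinTrees := by
    rw [measurable_pi_iff]
    rintro ⟨n | n, u⟩
    · exact (measurable_pi_apply (n, u)).comp measurable_fst
    · exact (measurable_pi_apply (n, u)).comp measurable_snd
  refine Measure.eq_infinitePi _ fun s t ht => ?_
  set e₁ : Label ℕ → Label ℤ := fun v => (Int.ofNat v.1, v.2)
  set e₂ : Label ℕ → Label ℤ := fun v => (Int.negSucc v.1, v.2)
  have h₁ : Function.Injective e₁ := by rintro ⟨a, b⟩ ⟨a', b'⟩ h; simpa [e₁] using h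
  have h₂ : Function.Injective e₂ := by rintro ⟨a, b⟩ ⟨a', b'⟩ h; simpa [e₂] using h
  have hbox : joinTrees ⁻¹' (Set.pi (s : Set (Label ℤ)) t) =
      (Set.pi (↑(s.preimage e₁ h₁.injOn) : Set (Label ℕ)) fun v => t (e₁ v)) ×ˢ
      (Set.pi (↑(s.preimage e₂ h₂.injOn) : Set (Label ℕ)) fun v => t (e₂ v)) := by
    ext x
    simp only [Set.mem_preimage, Set.mem_pi, Finset.mem_coe, Set.mem_prod, Finset.mem_preimage]
    constructor
    · intro h
      exact ⟨fun v hv => h _ hv, fun v hv => h _ hv⟩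
    · rintro ⟨h, h'⟩ ⟨n | n, u⟩ hv
      · exact h (n, u) hv
      · exact h' (n, u) hv
  rw [ibicgw, Measure.map_apply hmeas (MeasurableSet.pi s.countable_toSet fun i _ => ht i), hbox,
    Measure.prod_prod, iicgw, Measure.infinitePi_pi _ (fun i _ => ht _),
    Measure.infinitePi_pi _ (fun i _ => ht _)]
  classical
  rw [Finset.prod_preimage' e₁ s h₁.injOn
      (fun v => (offspringLaw p hp v.2).toMeasure (t v)),
    Finset.prod_preimage' e₂ s h₂.injOn
      (fun v => (offspringLaw p hp v.2).toMeasure (t v)),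
    ← Finset.prod_filter_mul_prod_filter_not s (fun v => v ∈ Set.range e₁)]
  congr 1
  refine Finset.prod_congr (Finset.filter_congr ?_) fun _ _ => rfl
  rintro ⟨n | n, u⟩ _ <;> simp [e₁, e₂]

/-! ### Concentration of signed sums of independent jumps. -/

section SignedSum

variable {ι : Type*} [DecidableEq ι] {d : ℕ} (κ : ι → Measure (Fin d → ℤ))
  [∀ i, IsProbabilityMeasure (κ i)] (ε : ι → ℤ)

lemma infinitePi_sum_insert {a : ι} {T : Finset ι} (ha : a ∉ T) (x : Fin d → ℤ) :
    Measure.infinitePi κ {X | ∑ i ∈ insert a T, ε i • X i = x} =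
      ∫⁻ y, Measure.infinitePi κ {X | ∑ i ∈ T, ε i • X i = x - ε a • y} ∂(κ a) := by
  have hm : ∀ i, Measurable fun X : ι → Fin d → ℤ => ε i • X i := fun i =>
    (Measurable.of_discrete (f := fun y : Fin d → ℤ => ε i • y)).comp (measurable_pi_apply i)
  have hms : Measurable fun X : ι → Fin d → ℤ => ∑ i ∈ T, ε i • X i :=
    Finset.measurable_sum _ fun i _ => hm i
  have hind' : ProbabilityTheory.IndepFun (fun X : ι → Fin d → ℤ => ∑ i ∈ T, ε i • X i)
      (fun X => X a) (Measure.infinitePi κ) := by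
    have h := ProbabilityTheory.iIndepFun_infinitePi (P := κ) (X := fun i y => y)
      (fun i => measurable_id)
    have h2 := h.indepFun_finset T {a} (by simpa using ha) (fun i => measurable_pi_apply i)
    have hφ : Measurable fun z : T → Fin d → ℤ => ∑ i : T, ε i • z i :=
      Finset.measurable_sum _ fun i _ =>
        (Measurable.of_discrete (f := fun y : Fin d → ℤ => ε i • y)).comp (measurable_pi_apply i)
    have hψ : Measurable fun z : ({a} : Finset ι) → Fin d → ℤ => z ⟨a, by simp⟩ :=
      measurable_pi_apply _
    have h3 := h2.comp hφ hψ
    convert h3 using 1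
    · ext1 X
      exact (Finset.sum_coe_sort T fun i => ε i • X i).symm
    · rfl
  have hset : {X : ι → Fin d → ℤ | ∑ i ∈ insert a T, ε i • X i = x} =
      ⋃ y, ((fun X => ∑ i ∈ T, ε i • X i) ⁻¹' {x - ε a • y} ∩ (fun X => X a) ⁻¹' {y}) := by
    ext X
    simp only [Finset.sum_insert ha, Set.mem_ofPred_eq, Set.mem_iUnion, Set.mem_inter_iff,
      Set.mem_preimage, Set.mem_singleton_iff, exists_eq_right']
    rw [eq_sub_iff_add_eq, add_comm]
  rw [hset, measure_iUnion, lintegral_countable']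
  · refine tsum_congr fun y => ?_
    rw [hind'.measure_inter_preimage_eq_mul _ _ (measurableSet_singleton _)
      (measurableSet_singleton _)]
    congr 1
    exact (measurePreserving_eval_infinitePi κ a).measure_preimage
      (measurableSet_singleton _).nullMeasurableSet
  · intro y z hyz
    refine Set.disjoint_left.2 fun X h h' => hyz ?_
    exact h.2.symm.trans h'.2
  · exact fun y => (hms (measurableSet_singleton _)).inter
      (measurable_pi_apply a (measurableSet_singleton _))

/-- Convolution with any further independent law cannot raise the largest atom. The deterministic
core jumps can therefore be ignored. -/
lemma infinitePi_sum_union_le {B : ENNReal} {S : Finset ι}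
    (h : ∀ x, Measure.infinitePi κ {X | ∑ i ∈ S, ε i • X i = x} ≤ B) {T : Finset ι} (hST : S ⊆ T)
    (x : Fin d → ℤ) : Measure.infinitePi κ {X | ∑ i ∈ T, ε i • X i = x} ≤ B := by
  rw [← Finset.union_sdiff_of_subset hST]
  have hdisj : Disjoint S (T \ S) := Finset.disjoint_sdiff
  generalize T \ S = R at hdisj
  induction R using Finset.induction_on generalizing x with
  | empty => simpa using h x
  | insert a R ha ih =>
    rw [Finset.disjoint_insert_right] at hdisj
    rw [Finset.union_insert, infinitePi_sum_insert κ ε (by simp [ha, hdisj.1])]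
    refine (lintegral_mono fun y => ih _ hdisj.2).trans ?_
    simp

lemma lintegral_srwStep (d : ℕ) [NeZero d] (h : (Fin d → ℤ) → ENNReal) :
    ∫⁻ y, h y ∂(srwStep d).toMeasure = (∑ s, h (unitVector d s)) / (2 * d) := by
  have hm : Measurable (unitVector d) := Measurable.of_discrete
  rw [srwStep, ← PMF.toMeasure_map _ _ hm, lintegral_map Measurable.of_discrete hm,
    lintegral_fintype, ENNReal.div_eq_inv_mul, Finset.mul_sum]
  refine Finset.sum_congr rfl fun s _ => ?_
  rw [PMF.toMeasure_apply_singleton _ _ (measurableSet_singleton _), PMF.uniformOfFintype_apply,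
    mul_comm]
  simp [mul_comm]

variable [NeZero d]

/-- The step law is symmetric, so the signs do not matter. -/
lemma infinitePi_sum_eq_walkCount (hε : ∀ i, ε i = 1 ∨ ε i = -1) {S : Finset ι}
    (hS : ∀ i ∈ S, κ i = (srwStep d).toMeasure) (x : Fin d → ℤ) :
    Measure.infinitePi κ {X | ∑ i ∈ S, ε i • X i = x} =
      walkCount d S.card x / (2 * d) ^ S.card := by
  induction S using Finset.induction_on generalizing x with
  | empty =>
    by_cases hx : x = 0
    · simp [walkCount_zero, hx]
    · simp [walkCount_zero, hx, Ne.symm hx]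
  | insert a S ha ih =>
    rw [infinitePi_sum_insert κ ε ha, hS a (by simp), lintegral_srwStep,
      Finset.card_insert_of_notMem ha, walkCount_succ]
    simp_rw [ih (fun i hi => hS i (by simp [hi]))]
    have hsum : ∑ s : Fin d × Bool, walkCount d S.card (x - ε a • unitVector d s) =
        ∑ s : Fin d × Bool, walkCount d S.card (x - unitVector d s) := by
      rcases hε a with h | h
      · simp [h]
      · let e : (Fin d × Bool) ≃ (Fin d × Bool) := (Equiv.refl _).prodCongr Equiv.boolNot
        rw [← e.sum_comp]
        refine Finset.sum_congr rfl fun s _ => ?_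
        congr 1
        rcases s with ⟨i, b⟩
        cases b <;> simp [h, e, unitVector, ← Pi.single_neg, sub_eq_add_neg]
    rw [← hsum]
    simp_rw [ENNReal.div_eq_inv_mul, ← Finset.mul_sum]
    rw [← mul_assoc, pow_succ, Nat.cast_sum, ← ENNReal.mul_inv (Or.inr (by finiteness))
      (Or.inl (by finiteness)), mul_comm (2 * (d : ENNReal))]

/-- Local limit upper bound for a signed sum of independent jumps, of which those in `S` are
simple random walk steps. -/
lemma infinitePi_sum_le (hd : 10 < d) (hε : ∀ i, ε i = 1 ∨ ε i = -1) {S T : Finset ι}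
    (hST : S ⊆ T) (hS : ∀ i ∈ S, κ i = (srwStep d).toMeasure) (x : Fin d → ℤ) :
    Measure.infinitePi κ {X | ∑ i ∈ T, ε i • X i = x} ≤
      ENNReal.ofReal (√(d ^ d) * ((S.card : ℝ) + 1) ^ (-(11 / 2) : ℝ)) := by
  refine infinitePi_sum_union_le κ ε (fun x => ?_) hST x
  rw [infinitePi_sum_eq_walkCount κ ε hε hS]
  have hd0 : (0 : ℝ) < d := by exact_mod_cast Nat.pos_of_ne_zero (NeZero.ne d)
  have h := walkCount_div_sq_le d S.card x
  have e : (walkCount d S.card x : ENNReal) / (2 * d) ^ S.card =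
      ENNReal.ofReal ((walkCount d S.card x : ℝ) / (2 * d) ^ S.card) := by
    rw [ENNReal.ofReal_div_of_pos (by positivity), ENNReal.ofReal_natCast,
      ENNReal.ofReal_pow (by positivity), ENNReal.ofReal_mul (by positivity)]
    simp
  rw [e]
  refine ENNReal.ofReal_le_ofReal (abs_le_of_sq_le_sq' (h.trans ?_) (by positivity)).2
  have h1 : (1 : ℝ) ≤ (S.card : ℝ) + 1 := by simp
  rw [mul_pow, Real.sq_sqrt (by positivity), ← Real.rpow_natCast (_ ^ _) 2,
    ← Real.rpow_mul (by positivity), div_eq_mul_inv]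
  gcongr
  rw [← Real.rpow_natCast _ d, ← Real.rpow_neg (by positivity)]
  -- After squaring, the exponents to compare are -d and -11.
  refine Real.rpow_le_rpow_of_exponent_le h1 ?_
  have : (11 : ℝ) ≤ d := by exact_mod_cast hd
  push_cast
  linarith

end SignedSum

/-! ### First moments of the bushes. -/

section Reach

variable (m : Label ℤ → Measure ℕ)

/-- Probability that `(n, u)` is a vertex of the tree, when the offspring numbers have laws `m`. -/
noncomputable def reach (n : ℤ) : List ℕ → ENNReal
  | [] => 1
  | j :: u => reach n u * m (n, u) (Set.Ioi j)

/-- Being in the tree constrains only the offspring numbers of the strict ancestors, one condition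
for each. Labels over distinct backbone indices have disjoint sets of such ancestors, hence
independence. -/
lemma exists_box_eq_inTree (n : ℤ) (u : List ℕ) :
    ∃ (s : Finset (Label ℤ)) (t : Label ℤ → Set ℕ),
      (∀ i ∈ s, i.1 = n ∧ i.2.length < u.length) ∧
      {ξ | InTree ξ n u} = Set.pi (s : Set (Label ℤ)) t ∧ ∏ i ∈ s, m i (t i) = reach m n u := by
  induction u with
  | nil => exact ⟨∅, fun _ => Set.univ, by simp, by simp [InTree], by simp [reach]⟩
  | cons j u ih =>
    obtain ⟨s, t, h1, h2, h3⟩ := ih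
    have hn : (n, u) ∉ s := fun h => lt_irrefl _ (h1 _ h).2
    refine ⟨insert (n, u) s, Function.update t (n, u) (Set.Ioi j), ?_, ?_, ?_⟩
    · intro i hi
      rcases Finset.mem_insert.1 hi with rfl | hi
      · simp
      · exact ⟨(h1 i hi).1, by simpa using (h1 i hi).2.trans (Nat.lt_succ_self _)⟩
    · ext ξ
      have h2' : InTree ξ n u ↔ ∀ i ∈ s, ξ i ∈ t i := by
        simpa [Set.mem_pi] using Set.ext_iff.1 h2 ξ
      simp only [InTree, Set.mem_ofPred_eq, h2', Set.mem_pi, Finset.coe_insert, Set.mem_insert_iff,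
        Finset.mem_coe, forall_eq_or_imp, Function.update_self, Set.mem_Ioi]
      rw [and_comm]
      refine and_congr Iff.rfl (forall₂_congr fun i hi => ?_)
      rw [Function.update_of_ne (ne_of_mem_of_not_mem hi hn)]
    · rw [Finset.prod_insert hn, Function.update_self, reach, mul_comm, ← h3]
      congr 1
      refine Finset.prod_congr rfl fun i hi => ?_
      rw [Function.update_of_ne (ne_of_mem_of_not_mem hi hn)]

lemma infinitePi_inTree_and_inTree [∀ i, IsProbabilityMeasure (m i)] {n n' : ℤ} (hn : n ≠ n')
    (u u' : List ℕ) : Measure.infinitePi m {ξ | InTree ξ n u ∧ InTree ξ n' u'} =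
      reach m n u * reach m n' u' := by
  obtain ⟨s, t, h1, h2, h3⟩ := exists_box_eq_inTree m n u
  obtain ⟨s', t', h1', h2', h3'⟩ := exists_box_eq_inTree m n' u'
  have hd : Disjoint s s' := Finset.disjoint_left.2 fun i hi hi' =>
    hn ((h1 i hi).1.symm.trans (h1' i hi').1)
  have : {ξ | InTree ξ n u ∧ InTree ξ n' u'} =
      Set.pi (↑(s ∪ s') : Set (Label ℤ)) (fun i => if i ∈ s then t i else t' i) := by
    change {ξ | InTree ξ n u} ∩ {ξ | InTree ξ n' u'} = _
    rw [h2, h2']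
    ext ξ
    simp only [Set.mem_inter_iff, Set.mem_pi, Finset.coe_union, Set.mem_union, Finset.mem_coe,
      or_imp, forall_and]
    refine and_congr (forall₂_congr fun i hi => by simp [hi]) (forall₂_congr fun i hi => ?_)
    rw [if_neg (Finset.disjoint_right.1 hd hi)]
  rw [this, Measure.infinitePi_pi _ (fun _ _ => MeasurableSet.of_discrete), Finset.prod_union hd,
    ← h3, ← h3']
  congr 1
  · exact Finset.prod_congr rfl fun i hi => by simp [hi]
  · exact Finset.prod_congr rfl fun i hi => by rw [if_neg (Finset.disjoint_right.1 hd hi)]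

lemma tsum_list_eq (f : List ℕ → ENNReal) :
    ∑' u, f u = f [] + ∑' u, ∑' j, f (j :: u) := by
  let e : Unit ⊕ (List ℕ × ℕ) ≃ List ℕ :=
    { toFun := Sum.elim (fun _ => []) fun v => v.2 :: v.1
      invFun := fun u => match u with
        | [] => Sum.inl ()
        | j :: u => Sum.inr (u, j)
      left_inv := by rintro (_ | ⟨u, j⟩) <;> rfl
      right_inv := by rintro (_ | ⟨j, u⟩) <;> rfl }
  rw [← e.tsum_eq, Summable.tsum_sum ENNReal.summable ENNReal.summable, ← ENNReal.tsum_prod]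
  simp [e]

variable {m} {n : ℤ} {σ : ENNReal}

/-- Since the tails P[ξ > j] sum to E[ξ], the left side is the mean size of a generation; it is at
most `σ` for the first one and does not increase afterwards. -/
lemma tsum_reach_length_succ_le (h0 : ∑' j, m (n, []) (Set.Ioi j) ≤ σ)
    (h1 : ∀ j u, ∑' k, m (n, j :: u) (Set.Ioi k) ≤ 1) (l : ℕ) :
    ∑' u, (if u.length = l + 1 then reach m n u else 0) ≤ σ := by
  induction l with
  | zero =>
    rw [tsum_list_eq]
    simp only [List.length_nil, zero_add, zero_ne_one, if_false, List.length_cons,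
      Nat.add_eq_right]
    rw [tsum_eq_single ([] : List ℕ) fun u hu => by simp [hu]]
    simpa [reach] using h0
  | succ l ih =>
    rw [tsum_list_eq]
    simp only [List.length_nil, List.length_cons, add_left_inj]
    rw [if_neg (by omega), zero_add]
    refine le_trans (ENNReal.tsum_le_tsum fun u => ?_) ih
    split_ifs with h
    · obtain ⟨j, u, rfl⟩ := List.exists_cons_of_length_eq_add_one h
      simp only [reach.eq_2 m n _ (j :: u), ENNReal.tsum_mul_left]
      exact mul_le_of_le_one_right zero_le (h1 j u)
    · simp

/-- First moment bound for the vertices of a bush, weighted by a function of the generation. -/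
lemma tsum_reach_mul_le (h0 : ∑' j, m (n, []) (Set.Ioi j) ≤ σ)
    (h1 : ∀ j u, ∑' k, m (n, j :: u) (Set.Ioi k) ≤ 1) (g : ℕ → ENNReal) :
    ∑' u, reach m n u * g u.length ≤ (1 + σ) * ∑' l, g l := by
  have e : ∀ u : List ℕ, reach m n u * g u.length =
      ∑' l, (if u.length = l then reach m n u else 0) * g l := by
    intro u
    rw [tsum_eq_single u.length fun l hl => by simp [hl.symm]]
    simp
  simp_rw [e]
  rw [ENNReal.tsum_comm, ← ENNReal.tsum_mul_left]
  refine ENNReal.tsum_le_tsum fun l => ?_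
  rw [ENNReal.tsum_mul_right]
  gcongr
  cases l with
  | zero =>
    rw [tsum_eq_single ([] : List ℕ) fun u hu => by simp [hu]]
    simp [reach]
  | succ l => exact (tsum_reach_length_succ_le h0 h1 l).trans le_add_self

end Reach

/-! ### Means and atoms of the offspring laws. -/

lemma tsum_toMeasure_Ioi (q : PMF ℕ) :
    ∑' j, q.toMeasure (Set.Ioi j) = ∑' k : ℕ, (k : ENNReal) * q k := by
  simp_rw [PMF.toMeasure_apply q measurableSet_Ioi]
  rw [ENNReal.tsum_comm]
  refine tsum_congr fun k => ?_
  rw [tsum_eq_sum (s := Finset.range k) fun j hj => by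
    rw [Set.indicator_of_notMem]; simpa using hj]
  rw [Finset.sum_congr rfl fun j hj => Set.indicator_of_mem (by simpa using hj) _]
  simp

lemma tsum_mul_map_apply (q : PMF ℕ) (f : ℕ → ℕ) :
    ∑' k : ℕ, (k : ENNReal) * q.map f k = ∑' k : ℕ, (f k : ENNReal) * q k := by
  simp_rw [PMF.map_apply, ← ENNReal.tsum_mul_left]
  rw [ENNReal.tsum_comm]
  refine tsum_congr fun k => ?_
  rw [tsum_eq_single (f k) fun j hj => by simp [hj]]
  simp

variable {p : PMF ℕ} (hp : IsCritical p)

lemma tsum_offspringLaw_cons (j : ℕ) (u : List ℕ) :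
    ∑' k, (offspringLaw p hp (j :: u)).toMeasure (Set.Ioi k) = 1 := by
  rw [tsum_toMeasure_Ioi]; exact hp

lemma tsum_offspringLaw_nil_le :
    ∑' k, (offspringLaw p hp []).toMeasure (Set.Ioi k) ≤ ∑' k : ℕ, (k : ENNReal) ^ 2 * p k := by
  rw [tsum_toMeasure_Ioi, offspringLaw, tsum_mul_map_apply]
  refine ENNReal.tsum_le_tsum fun k => ?_
  change ((k - 1 : ℕ) : ENNReal) * (k * p k) ≤ _
  rw [← mul_assoc, sq]
  gcongr
  exact Nat.sub_le _ _

/-- If Z ≥ 1 almost surely, then E[Z - 1] = 0 forces Z = 1. Positivity of `p 0` is what allows the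
type B vertices of the core to be childless. -/
lemma apply_zero_ne_zero (hp : IsCritical p) (hne : p ≠ PMF.pure 1) : p 0 ≠ 0 := by
  intro h0
  have h1 : ∑' k : ℕ, ((k - 1 : ℕ) : ENNReal) * p k = 0 := by
    have e : ∑' k : ℕ, (k : ENNReal) * p k =
        ∑' k : ℕ, p k + ∑' k : ℕ, ((k - 1 : ℕ) : ENNReal) * p k := by
      rw [← ENNReal.tsum_add]
      refine tsum_congr fun k => ?_
      rcases k with _ | k
      · simp [h0]
      · push_cast [Nat.add_sub_cancel]; ring
    have hp' : ∑' k : ℕ, (k : ENNReal) * p k = 1 := hp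
    rw [hp', p.tsum_coe] at e
    have : (1 : ENNReal) + 0 = 1 + ∑' k : ℕ, ((k - 1 : ℕ) : ENNReal) * p k := by simpa using e
    exact ((ENNReal.add_right_inj ENNReal.one_ne_top).1 this).symm
  have h2 : ∀ k, k ≠ 1 → p k = 0 := by
    intro k hk
    rcases k with _ | _ | k
    · exact h0
    · exact absurd rfl hk
    · have := ENNReal.tsum_eq_zero.1 h1 (k + 2)
      rcases mul_eq_zero.1 this with h | h
      · simp at h
      · exact h
  apply hne
  have h3 : p 1 = 1 := by
    rw [← p.tsum_coe, tsum_eq_single 1 h2]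
  ext1 k
  by_cases hk : k = 1
  · simp [hk, h3]
  · simp [hk, h2 k hk]


/-! ### Geometry of the core and of paths leaving it. -/

/-- Labels of the backbone vertices with index in `[-N, N]` and of their first `r` children. -/
noncomputable def core (N r : ℕ) : Finset (Label ℤ) :=
  (Finset.Icc (-N : ℤ) N).image (fun n => (n, [])) ∪
    (Finset.Icc (-N : ℤ) N ×ˢ Finset.range r).image (fun v => (v.1, [v.2]))

lemma mem_core {N r : ℕ} {n : ℤ} {u : List ℕ} :
    (n, u) ∈ core N r ↔ n.natAbs ≤ N ∧ (u = [] ∨ ∃ j < r, u = [j]) := by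
  have h : n.natAbs ≤ N ↔ -(N : ℤ) ≤ n ∧ n ≤ N := by omega
  simp only [core, Finset.mem_union, Finset.mem_image, Finset.mem_Icc, Prod.mk.injEq,
    Finset.mem_product, Finset.mem_range, Prod.exists, h]
  constructor
  · rintro (⟨a, ha, rfl, rfl⟩ | ⟨a, b, ⟨ha, hb⟩, rfl, rfl⟩)
    · exact ⟨ha, Or.inl rfl⟩
    · exact ⟨ha, Or.inr ⟨b, hb, rfl⟩⟩
  · rintro ⟨ha, rfl | ⟨j, hj, rfl⟩⟩
    · exact Or.inl ⟨n, ha, rfl, rfl⟩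
    · exact Or.inr ⟨n, j, ⟨ha, hj⟩, rfl, rfl⟩

/-- Labels of the edges on the path from the root to `(n, u)`. -/
noncomputable def path (n : ℤ) : List ℕ → Finset (Label ℤ)
  | [] => (Finset.Icc 1 n ∪ Finset.Icc n (-1)).image fun k => (k, [])
  | j :: u => insert (n, j :: u) (path n u)

lemma mem_path_snd_length {n : ℤ} {u : List ℕ} {i : Label ℤ} (hi : i ∈ path n u) :
    i.2.length ≤ u.length := by
  induction u with
  | nil =>
    obtain ⟨k, -, rfl⟩ := Finset.mem_image.1 hi
    simp
  | cons j u ih =>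
    rcases Finset.mem_insert.1 hi with rfl | hi
    · simp
    · exact (ih hi).trans (by simp)

lemma cons_notMem_path (n : ℤ) (j : ℕ) (u : List ℕ) : (n, j :: u) ∉ path n u := fun h => by
  simpa using mem_path_snd_length h

lemma mem_path_fst {n : ℤ} {u : List ℕ} {i : Label ℤ} (hi : i ∈ path n u) : 1 ≤ i.1 ↔ 1 ≤ n := by
  induction u with
  | nil =>
    obtain ⟨k, hk, rfl⟩ := Finset.mem_image.1 hi
    simp only [Finset.mem_union, Finset.mem_Icc] at hk
    omega
  | cons j u ih =>
    rcases Finset.mem_insert.1 hi with rfl | hi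
    · simp
    · exact ih hi

lemma position_eq_sum_path {d : ℕ} (X : Label ℤ → Fin d → ℤ) (n : ℤ) (u : List ℕ) :
    position X n u = ∑ i ∈ path n u, X i := by
  induction u with
  | nil =>
    rw [position, backbone, path, Finset.sum_image fun a _ b _ h => by simpa using h,
      Finset.sum_union]
    refine Finset.disjoint_left.2 fun k hk hk' => ?_
    rw [Finset.mem_Icc] at hk hk'
    omega
  | cons j u ih =>
    rw [position, path, Finset.sum_insert (cons_notMem_path n j u), ih, add_comm]

/-- Number of edges on the path from the root to `(n, u)` which are not in the core. -/
noncomputable def freeCount (N r : ℕ) (n : ℤ) (u : List ℕ) : ℕ := (path n u \ core N r).card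

lemma freeCount_cons_of_mem {N r : ℕ} {n : ℤ} {j : ℕ} {u : List ℕ}
    (h : (n, j :: u) ∈ core N r) : freeCount N r n (j :: u) = freeCount N r n u := by
  rw [freeCount, path, Finset.insert_sdiff_of_mem _ h, freeCount]

lemma freeCount_cons_of_notMem {N r : ℕ} {n : ℤ} {j : ℕ} {u : List ℕ}
    (h : (n, j :: u) ∉ core N r) : freeCount N r n (j :: u) = freeCount N r n u + 1 := by
  rw [freeCount, path, Finset.insert_sdiff_of_notMem _ h, Finset.card_insert_of_notMem, freeCount]
  simp [cons_notMem_path]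

lemma le_freeCount_nil (N r : ℕ) (n : ℤ) : n.natAbs - N ≤ freeCount N r n [] := by
  have hinj : Function.Injective fun k : ℤ => ((k, []) : Label ℤ) := fun a b h => by simpa using h
  have : ((Finset.Icc (N + 1 : ℤ) n ∪ Finset.Icc n (-N - 1 : ℤ)).image
      fun k => ((k, []) : Label ℤ)) ⊆ path n [] \ core N r := by
    intro i hi
    obtain ⟨k, hk, rfl⟩ := Finset.mem_image.1 hi
    simp only [Finset.mem_union, Finset.mem_Icc] at hk
    rw [Finset.mem_sdiff, mem_core, path]
    refine ⟨Finset.mem_image_of_mem _ ?_, ?_⟩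
    · simp only [Finset.mem_union, Finset.mem_Icc]; omega
    · rintro ⟨h, -⟩; omega
  refine le_trans ?_ (Finset.card_le_card this)
  rw [Finset.card_image_of_injective _ hinj, Finset.card_union_of_disjoint, Int.card_Icc,
    Int.card_Icc]
  · omega
  · refine Finset.disjoint_left.2 fun k hk hk' => ?_
    rw [Finset.mem_Icc] at hk hk'
    omega

/-- A bush rooted beyond the core contains no core label, so all its edges are free, in addition to
the backbone edges past index `N` in absolute value. -/
lemma le_freeCount {N r : ℕ} {n : ℤ} (hn : N < n.natAbs) (u : List ℕ) :
    n.natAbs - N + u.length ≤ freeCount N r n u := by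
  induction u with
  | nil => simpa using le_freeCount_nil N r n
  | cons j u ih =>
    rw [freeCount_cons_of_notMem fun h => by have := (mem_core.1 h).1; omega, List.length_cons]
    omega

lemma freeCount_eq_zero {N r : ℕ} {n : ℤ} {u : List ℕ} (h : (n, u) ∈ core N r) :
    freeCount N r n u = 0 := by
  obtain ⟨hn, hu⟩ := mem_core.1 h
  have h0 : freeCount N r n [] = 0 := by
    rw [freeCount, Finset.card_eq_zero, Finset.sdiff_eq_empty_iff_subset]
    intro i hi
    obtain ⟨k, hk, rfl⟩ := Finset.mem_image.1 hi
    simp only [Finset.mem_union, Finset.mem_Icc] at hk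
    refine mem_core.2 ⟨?_, Or.inl rfl⟩
    omega
  rcases hu with rfl | ⟨j, hj, rfl⟩
  · exact h0
  · rw [freeCount_cons_of_mem h, h0]

/-- The jumps along the edges of the core: the backbone is straight, in the direction of the
axis `a`, and the other edges are parallel to the axis `b`. -/
noncomputable def coreJump {d : ℕ} (a b : Fin d) : Label ℤ → Fin d → ℤ
  | (n, []) => unitVector d (a, decide (1 ≤ n))
  | (_, _ :: _) => unitVector d (b, true)

section Position

variable {d : ℕ} {a b : Fin d} {X : Label ℤ → Fin d → ℤ} {N r : ℕ}

/-- Along axis `a`, each backbone edge of the core gains 1, its bush edges are neutral because they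
are parallel to `b`, and a free edge loses at most 1. -/
lemma le_position (hab : a ≠ b) (hX : ∀ v, |X v a| ≤ 1)
    (hc : ∀ v ∈ core N r, X v = coreJump a b v) {n : ℤ} (hn : 1 ≤ n) (u : List ℕ) :
    min n N ≤ position X n u a + freeCount N r n u := by
  induction u with
  | nil =>
    have h1 : ∑ k ∈ Finset.Icc 1 n, (if k ≤ N then 1 else -1 : ℤ) ≤ position X n [] a := by
      rw [position, backbone, Finset.Icc_eq_empty_of_lt (show (-1 : ℤ) < n by omega),
        Finset.sum_empty, add_zero, Finset.sum_apply]
      refine Finset.sum_le_sum fun k hk => ?_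
      rw [Finset.mem_Icc] at hk
      split_ifs with h
      · rw [hc _ (mem_core.2 ⟨by omega, Or.inl rfl⟩)]
        simp [coreJump, unitVector, hk.1]
      · exact (abs_le.1 (hX _)).1
    have e1 : (Finset.Icc 1 n).filter (fun k => k ≤ (N : ℤ)) = Finset.Icc 1 (min n N) := by
      ext k; simp only [Finset.mem_filter, Finset.mem_Icc]; omega
    have e2 : (Finset.Icc 1 n).filter (fun k => ¬ k ≤ (N : ℤ)) = Finset.Icc (N + 1 : ℤ) n := by
      ext k; simp only [Finset.mem_filter, Finset.mem_Icc]; omega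
    rw [Finset.sum_ite, e1, e2, Finset.sum_const, Finset.sum_const, Int.card_Icc,
      Int.card_Icc] at h1
    have h2 := le_freeCount_nil N r n
    simp only [nsmul_eq_mul] at h1
    omega
  | cons j u ih =>
    rw [position, Pi.add_apply]
    by_cases h : (n, j :: u) ∈ core N r
    · rw [freeCount_cons_of_mem h, hc _ h]
      simpa [coreJump, unitVector, hab] using ih
    · rw [freeCount_cons_of_notMem h]
      have := (abs_le.1 (hX (n, j :: u))).1
      push_cast
      linarith

lemma position_le (hab : a ≠ b) (hX : ∀ v, |X v a| ≤ 1)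
    (hc : ∀ v ∈ core N r, X v = coreJump a b v) {n : ℤ} (hn : n ≤ 0) (u : List ℕ) :
    position X n u a + min (-n) N ≤ freeCount N r n u := by
  induction u with
  | nil =>
    have h1 : position X n [] a ≤ ∑ k ∈ Finset.Icc n (-1), (if -N ≤ k then -1 else 1 : ℤ) := by
      rw [position, backbone, Finset.Icc_eq_empty_of_lt (show n < 1 by omega),
        Finset.sum_empty, zero_add, Finset.sum_apply]
      refine Finset.sum_le_sum fun k hk => ?_
      rw [Finset.mem_Icc] at hk
      split_ifs with h
      · rw [hc _ (mem_core.2 ⟨by omega, Or.inl rfl⟩)]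
        simp [coreJump, unitVector, show ¬ 1 ≤ k by omega]
      · exact (abs_le.1 (hX _)).2
    have e1 : (Finset.Icc n (-1)).filter (fun k => -(N : ℤ) ≤ k) =
        Finset.Icc (-(min (-n) N)) (-1) := by
      ext k; simp only [Finset.mem_filter, Finset.mem_Icc]; omega
    have e2 : (Finset.Icc n (-1)).filter (fun k => ¬ -(N : ℤ) ≤ k) =
        Finset.Icc n (-N - 1 : ℤ) := by
      ext k; simp only [Finset.mem_filter, Finset.mem_Icc]; omega
    rw [Finset.sum_ite, e1, e2, Finset.sum_const, Finset.sum_const, Int.card_Icc,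
      Int.card_Icc] at h1
    have h2 := le_freeCount_nil N r n
    simp only [nsmul_eq_mul] at h1
    omega
  | cons j u ih =>
    rw [position, Pi.add_apply]
    by_cases h : (n, j :: u) ∈ core N r
    · rw [freeCount_cons_of_mem h, hc _ h]
      simpa [coreJump, unitVector, hab] using ih
    · rw [freeCount_cons_of_notMem h]
      have := (abs_le.1 (hX (n, j :: u))).2
      push_cast
      linarith

/-- If bushes on the two sides of the edge from `0` to `1` meet outside the core, then the paths to
the meeting point have at least `N` edges outside of the core; they cannot meet in the core. -/
lemma le_freeCount_add_freeCount (hab : a ≠ b) (hX : ∀ v, |X v a| ≤ 1)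
    (hc : ∀ v ∈ core N r, X v = coreJump a b v) {n n' : ℤ} (hn : n ≤ 0) (hn' : 1 ≤ n')
    {u u' : List ℕ} (hu : n.natAbs ≤ N → (n, u) ∈ core N r)
    (hu' : n'.natAbs ≤ N → (n', u') ∈ core N r) (h : position X n u = position X n' u') :
    (N < n.natAbs ∨ N < n'.natAbs) ∧ N ≤ freeCount N r n u + freeCount N r n' u' := by
  have h1 := position_le hab hX hc hn u
  have h2 := le_position hab hX hc hn' u'
  rw [h] at h1
  have h3 : N < n.natAbs ∨ N < n'.natAbs := by
    -- With both vertices in the core there are no free edges, yet the `a` coordinates are at most 0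
    -- and at least `n' ≥ 1` respectively.
    by_contra! h3
    have e1 := freeCount_eq_zero (hu h3.1)
    have e2 := freeCount_eq_zero (hu' h3.2)
    omega
  exact ⟨h3, by omega⟩

end Position

lemma exists_of_not_isPivotal {d : ℕ} {ω : Sample d} (h : ¬ IsPivotal ω 0) :
    ∃ v w : Label ℤ, v.1 ≤ 0 ∧ 1 ≤ w.1 ∧ (InTree ω.1 v.1 v.2 ∧ InTree ω.1 w.1 w.2) ∧
      position ω.2 v.1 v.2 = position ω.2 w.1 w.2 := by
  obtain ⟨x, hx1, hx2⟩ := Set.nonempty_iff_ne_empty.2 h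
  simp only [bushes, Set.mem_iUnion, Set.mem_Iic, Set.mem_Ici, zero_add] at hx1 hx2
  obtain ⟨n, hn, u, hu, rfl⟩ := hx1
  obtain ⟨n', hn', u', hu', he⟩ := hx2
  exact ⟨(n, u), (n', u'), hn, hn', ⟨hu, hu'⟩, he.symm⟩

/-! ### Distributing the decay over the two vertices. -/

/-- The summable weights `(k + 1) ^ (-5 / 4)`. -/
noncomputable def decay (k : ℕ) : ENNReal := ENNReal.ofReal (((k : ℝ) + 1) ^ (-(5 / 4) : ℝ))

lemma tsum_decay_ne_top : ∑' k, decay k ≠ ⊤ := by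
  refine Summable.tsum_ofReal_ne_top ?_
  have := (Real.summable_one_div_nat_add_rpow 1 (5 / 4)).2 (by norm_num)
  refine this.congr fun k => ?_
  have h : (0 : ℝ) < k + 1 := by positivity
  rw [abs_of_pos h, Real.rpow_neg h.le, one_div]

/-- The weight of the label `(n, u)` in the estimate of the number of collisions. -/
noncomputable def weight (N : ℕ) (n : ℤ) (u : List ℕ) : ENNReal :=
  if n.natAbs ≤ N then (N : ENNReal)⁻¹ else decay (n.natAbs - N) * decay u.length

lemma decay_anti {k l : ℕ} (h : k ≤ l) : decay l ≤ decay k := by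
  refine ENNReal.ofReal_le_ofReal (Real.rpow_le_rpow_of_nonpos (by positivity) ?_ (by norm_num))
  have : (k : ℝ) ≤ l := by exact_mod_cast h
  linarith

/-- Outside the core, one factor pays for the distance along the backbone and the other for the
generation. Inside, the exponent 5/2 is more than enough for 1/N, which compensates for the number
of core indices. -/
lemma decay_sq_le_weight {N r t : ℕ} (hN : 1 ≤ N) (ht : N ≤ t) {n : ℤ} {u : List ℕ}
    (h : freeCount N r n u ≤ t) : decay t ^ 2 ≤ weight N n u := by
  unfold weight
  split_ifs with hn
  · have hN' : (0 : ℝ) < N := by exact_mod_cast hN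
    have ht' : (N : ℝ) ≤ t + 1 := by have : (N : ℝ) ≤ t := by exact_mod_cast ht
                                     linarith
    rw [decay, ← ENNReal.ofReal_pow (by positivity), ← ENNReal.ofReal_natCast N,
      ← ENNReal.ofReal_inv_of_pos hN']
    refine ENNReal.ofReal_le_ofReal ?_
    rw [← Real.rpow_natCast, ← Real.rpow_mul (by positivity)]
    calc ((t : ℝ) + 1) ^ (-(5 / 4) * ((2 : ℕ) : ℝ)) ≤ ((t : ℝ) + 1) ^ (-1 : ℝ) :=
          Real.rpow_le_rpow_of_exponent_le (by simp) (by norm_num)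
      _ = ((t : ℝ) + 1)⁻¹ := Real.rpow_neg_one _
      _ ≤ (N : ℝ)⁻¹ := by gcongr
  · have := le_freeCount (r := r) (not_le.1 hn) u
    rw [sq]
    exact mul_le_mul' (decay_anti (by omega)) (decay_anti (by omega))

lemma ofReal_rpow_le {N t : ℕ} (hN : 1 ≤ N) (ht : N ≤ t) {C : ℝ} (hC : 0 ≤ C) :
    ENNReal.ofReal (C * ((t : ℝ) + 1) ^ (-(11 / 2) : ℝ)) ≤
      ENNReal.ofReal (C * (N : ℝ) ^ (-(1 / 2) : ℝ)) * (decay t ^ 2 * decay t ^ 2) := by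
  have hN' : (0 : ℝ) < N := by exact_mod_cast hN
  have ht' : (N : ℝ) ≤ t + 1 := by have : (N : ℝ) ≤ t := by exact_mod_cast ht
                                   linarith
  rw [← pow_add, decay, ← ENNReal.ofReal_pow (by positivity), ← ENNReal.ofReal_mul (by positivity)]
  refine ENNReal.ofReal_le_ofReal ?_
  rw [mul_assoc]
  refine mul_le_mul_of_nonneg_left ?_ hC
  rw [← Real.rpow_natCast, ← Real.rpow_mul (by positivity)]
  calc ((t : ℝ) + 1) ^ (-(11 / 2) : ℝ)
      = ((t : ℝ) + 1) ^ (-(1 / 2) : ℝ) * ((t : ℝ) + 1) ^ (-(5 / 4) * ((2 + 2 : ℕ) : ℝ)) := by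
        rw [← Real.rpow_add (by positivity)]; norm_num
    _ ≤ _ := by
        gcongr ?_ * _
        exact Real.rpow_le_rpow_of_nonpos hN' ht' (by norm_num)

lemma tsum_int_indicator_decay_le (N : ℕ) :
    ∑' n : ℤ, (if n.natAbs ≤ N then 0 else decay (n.natAbs - N)) ≤ 2 * ∑' k, decay k := by
  have h : ∀ f : ℕ → ℕ, Function.Injective f →
      ∑' k : ℕ, (if f k ≤ N then 0 else decay (f k - N)) ≤ ∑' k, decay k := by
    intro f hf
    calc ∑' k : ℕ, (if f k ≤ N then 0 else decay (f k - N))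
        ≤ ∑' k : ℕ, (if k ≤ N then 0 else decay (k - N)) :=
          ENNReal.tsum_comp_le_tsum_of_injective hf (fun k => if k ≤ N then 0 else decay (k - N))
      _ = ∑ k ∈ Finset.range N, (if k ≤ N then 0 else decay (k - N)) +
            ∑' k : ℕ, (if k + N ≤ N then 0 else decay (k + N - N)) :=
          (ENNReal.summable.sum_add_tsum_nat_add' ).symm
      _ ≤ 0 + ∑' k, decay k := by
          gcongr with k
          · refine (Finset.sum_eq_zero fun k hk => if_pos ?_).le
            exact (Finset.mem_range.1 hk).le
          · split_ifs
            · exact zero_le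
            · rw [Nat.add_sub_cancel]
      _ = _ := zero_add _
  rw [tsum_of_nat_of_neg_add_one ENNReal.summable ENNReal.summable, two_mul]
  refine add_le_add ?_ ?_
  · exact h (fun k => (k : ℤ).natAbs) fun a b hab => by simpa using hab
  · refine h (fun k => (-((k : ℤ) + 1)).natAbs) fun a b hab => ?_
    simp only at hab
    omega

lemma abs_unitVector_le {d : ℕ} (s : Fin d × Bool) (i : Fin d) : |unitVector d s i| ≤ 1 := by
  rcases s with ⟨j, c⟩
  by_cases h : i = j
  · subst h; cases c <;> simp [unitVector]
  · simp [unitVector, h]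

/-! ### Collision probability under the conditioned law. -/

section Laws

variable {p : PMF ℕ} (hp : IsCritical p) (N r : ℕ)

/-- Offspring laws, conditioned so that the vertices in the bushes of the backbone vertices with
index in `[-N, N]` are exactly those of the core. -/
noncomputable def coreOffspring : Label ℤ → Measure ℕ :=
  pinned (fun v : Label ℤ => (offspringLaw p hp v.2).toMeasure) (core N r)
    (fun v => if v.2 = [] then r else 0)

instance (v : Label ℤ) : IsProbabilityMeasure (coreOffspring hp N r v) := by
  unfold coreOffspring; infer_instance

/-- Jump laws, conditioned on the jumps in the core. -/
noncomputable def coreStep {d : ℕ} [NeZero d] (a b : Fin d) : Label ℤ → Measure (Fin d → ℤ) :=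
  pinned (fun _ => (srwStep d).toMeasure) (core N r) (coreJump a b)

instance {d : ℕ} [NeZero d] (a b : Fin d) (v : Label ℤ) :
    IsProbabilityMeasure (coreStep N r a b v) := by
  unfold coreStep; infer_instance

variable {hp N r}

lemma reach_le_one {n : ℤ} (u : List ℕ) : reach (coreOffspring hp N r) n u ≤ 1 := by
  induction u with
  | nil => simp [reach]
  | cons j u ih => exact mul_le_one' ih prob_le_one

lemma mem_core_of_reach_ne_zero {n : ℤ} (hn : n.natAbs ≤ N) {u : List ℕ}
    (h : reach (coreOffspring hp N r) n u ≠ 0) : (n, u) ∈ core N r := by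
  induction u with
  | nil => exact mem_core.2 ⟨hn, Or.inl rfl⟩
  | cons j u ih =>
    obtain ⟨h1, h2⟩ := mul_ne_zero_iff.1 h
    rw [coreOffspring, pinned_of_mem _ _ (ih h1),
      Measure.dirac_apply' _ measurableSet_Ioi] at h2
    rcases (mem_core.1 (ih h1)).2 with rfl | ⟨k, -, rfl⟩
    · refine mem_core.2 ⟨hn, Or.inr ⟨j, ?_, rfl⟩⟩
      by_contra hj
      simp [hj] at h2
    · simp at h2

/-- The bound is free of `N`: the core has 2N + 1 ≤ 3N bushes of at most 1 + r vertices, each of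
weight 1/N, while outside it the sum factorises over backbone index and generation. -/
lemma tsum_reach_mul_weight_le {σ : ENNReal}
    (hσ : ∑' k : ℕ, (k : ENNReal) ^ 2 * p k ≤ σ) (hN : 1 ≤ N) :
    ∑' v : Label ℤ, reach (coreOffspring hp N r) v.1 v.2 * weight N v.1 v.2 ≤
      3 * (1 + r) + 2 * (∑' k, decay k) * ((1 + σ) * ∑' k, decay k) := by
  have hinner : ∀ n : ℤ, ∑' u, reach (coreOffspring hp N r) n u * weight N n u ≤
      (if n ∈ Finset.Icc (-N : ℤ) N then (1 + r) * (N : ENNReal)⁻¹ else 0) +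
        (if n.natAbs ≤ N then 0 else decay (n.natAbs - N)) * ((1 + σ) * ∑' k, decay k) := by
    intro n
    have hmem : n ∈ Finset.Icc (-N : ℤ) N ↔ n.natAbs ≤ N := by rw [Finset.mem_Icc]; omega
    by_cases hn : n.natAbs ≤ N
    · rw [if_pos (hmem.2 hn), if_pos hn, zero_mul, add_zero]
      simp only [weight, if_pos hn]
      rw [ENNReal.tsum_mul_right]
      gcongr
      set s : Finset (List ℕ) := insert [] ((Finset.range r).image fun j => [j])
      calc ∑' u, reach (coreOffspring hp N r) n u
          = ∑ u ∈ s, reach (coreOffspring hp N r) n u := by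
            refine tsum_eq_sum fun u hu => ?_
            by_contra h
            rcases (mem_core.1 (mem_core_of_reach_ne_zero hn h)).2 with rfl | ⟨j, hj, rfl⟩
            · simp [s] at hu
            · simp [s, hj.not_ge] at hu
        _ ≤ ∑ u ∈ s, 1 := Finset.sum_le_sum fun u _ => reach_le_one u
        _ = (s.card : ENNReal) := by simp
        _ ≤ ((1 + r : ℕ) : ENNReal) := by
            gcongr
            refine (Finset.card_insert_le _ _).trans ?_
            rw [add_comm]
            gcongr
            exact Finset.card_image_le.trans_eq (Finset.card_range r)
        _ = 1 + r := by push_cast; rfl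
    · rw [if_neg (mt hmem.1 hn), if_neg hn, zero_add]
      simp only [weight, if_neg hn]
      have hlaw : ∀ u, coreOffspring hp N r (n, u) = (offspringLaw p hp u).toMeasure := fun u =>
        pinned_of_notMem _ _ fun h => hn (mem_core.1 h).1
      have := tsum_reach_mul_le (m := coreOffspring hp N r) (n := n) (σ := σ)
        (by rw [hlaw]; exact (tsum_offspringLaw_nil_le hp).trans hσ)
        (fun j u => by rw [hlaw]; exact (tsum_offspringLaw_cons hp j u).le) decay
      calc ∑' u : List ℕ, reach (coreOffspring hp N r) n u *
            (decay (n.natAbs - N) * decay u.length)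
          = decay (n.natAbs - N) *
            ∑' u : List ℕ, reach (coreOffspring hp N r) n u * decay u.length := by
            rw [← ENNReal.tsum_mul_left]
            exact tsum_congr fun u => by ring
        _ ≤ _ := by gcongr
  rw [ENNReal.tsum_prod (f := fun n u => reach (coreOffspring hp N r) n u * weight N n u)]
  refine (ENNReal.tsum_le_tsum hinner).trans ?_
  rw [ENNReal.tsum_add, ENNReal.tsum_mul_right]
  gcongr
  · rw [tsum_eq_sum (s := Finset.Icc (-N : ℤ) N) fun n hn => if_neg hn,
      Finset.sum_congr rfl fun n hn => if_pos hn, Finset.sum_const, Int.card_Icc, nsmul_eq_mul,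
      show (N + 1 - -N : ℤ).toNat = 2 * N + 1 by omega, ← mul_assoc, ← div_eq_mul_inv]
    refine ENNReal.div_le_of_le_mul ?_
    rw [mul_right_comm]
    gcongr
    exact_mod_cast (show 2 * N + 1 ≤ 3 * N by omega)
  · exact tsum_int_indicator_decay_le N

variable {d : ℕ} [NeZero d] {a b : Fin d}

lemma ae_coreStep : ∀ᵐ X ∂Measure.infinitePi (coreStep N r a b),
    (∀ v, |X v a| ≤ 1) ∧ ∀ v ∈ core N r, X v = coreJump a b v := by
  have h : ∀ v : Label ℤ, ∀ᵐ X ∂Measure.infinitePi (coreStep N r a b),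
      |X v a| ≤ 1 ∧ (v ∈ core N r → X v = coreJump a b v) := by
    intro v
    have hv : ∀ᵐ y ∂(coreStep N r a b v), |y a| ≤ 1 ∧ (v ∈ core N r → y = coreJump a b v) := by
      by_cases hc : v ∈ core N r
      · rw [coreStep, pinned_of_mem _ _ hc, ae_dirac_iff MeasurableSet.of_discrete]
        refine ⟨?_, fun _ => rfl⟩
        rcases v with ⟨n, _ | ⟨j, u⟩⟩ <;> exact abs_unitVector_le _ _
      · rw [coreStep, pinned_of_notMem _ _ hc, srwStep,
          ← PMF.toMeasure_map _ _ Measurable.of_discrete,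
          ae_map_iff Measurable.of_discrete.aemeasurable MeasurableSet.of_discrete]
        exact Filter.Eventually.of_forall fun s => ⟨abs_unitVector_le _ _, fun h => absurd h hc⟩
    exact (measurePreserving_eval_infinitePi (coreStep N r a b) v).quasiMeasurePreserving.ae hv
  filter_upwards [ae_all_iff.2 h] with X hX
  exact ⟨fun v => (hX v).1, fun v => (hX v).2⟩

/-- Paths to the two sides of the edge between 0 and 1 share no edge, so the difference of the
positions is a signed sum of independent jumps, of which those off the core are random walk steps.
-/
lemma infinitePi_position_eq_le (hd : 10 < d) (n n' : ℤ) (hn : n ≤ 0) (hn' : 1 ≤ n')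
    (u u' : List ℕ) :
    Measure.infinitePi (coreStep N r a b) {X | position X n u = position X n' u'} ≤
      ENNReal.ofReal (√(d ^ d) * (((freeCount N r n u + freeCount N r n' u' : ℕ) : ℝ) + 1) ^
        (-(11 / 2) : ℝ)) := by
  have hdisj : Disjoint (path n u) (path n' u') := Finset.disjoint_left.2 fun i hi hi' => by
    have h1 := mem_path_fst hi
    have h2 := mem_path_fst hi'
    omega
  set ε : Label ℤ → ℤ := fun i => if 1 ≤ i.1 then -1 else 1
  have key := infinitePi_sum_le (coreStep N r a b) ε hd
    (fun i => by simp only [ε]; split_ifs <;> simp)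
    (S := (path n u ∪ path n' u') \ core N r) (T := path n u ∪ path n' u')
    Finset.sdiff_subset
    (fun i hi => pinned_of_notMem _ _ (Finset.mem_sdiff.1 hi).2) 0
  rw [Finset.union_sdiff_distrib, Finset.card_union_of_disjoint
    (Finset.disjoint_of_subset_left Finset.sdiff_subset
      (Finset.disjoint_of_subset_right Finset.sdiff_subset hdisj))] at key
  refine le_trans (measure_mono fun X hX => ?_) key
  have hX' : position X n u = position X n' u' := hX
  rw [position_eq_sum_path, position_eq_sum_path] at hX'
  change ∑ i ∈ path n u ∪ path n' u', ε i • X i = 0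
  rw [Finset.sum_union hdisj,
    Finset.sum_congr rfl fun i hi => show ε i • X i = X i by
      simp only [ε]
      rw [if_neg fun h => by have := (mem_path_fst hi).1 h; omega, one_smul],
    Finset.sum_congr (s₁ := path n' u') rfl fun i hi => show ε i • X i = -X i by
      simp only [ε]
      rw [if_pos ((mem_path_fst hi).2 hn'), neg_smul, one_smul],
    Finset.sum_neg_distrib, hX', add_neg_cancel]

lemma infinitePi_position_eq_le_weight (hd : 10 < d) (hab : a ≠ b) (hN : 1 ≤ N) {n n' : ℤ}
    (hn : n ≤ 0) (hn' : 1 ≤ n') {u u' : List ℕ} (hu : n.natAbs ≤ N → (n, u) ∈ core N r)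
    (hu' : n'.natAbs ≤ N → (n', u') ∈ core N r) :
    Measure.infinitePi (coreStep N r a b) {X | position X n u = position X n' u'} ≤
      ENNReal.ofReal (√(d ^ d) * (N : ℝ) ^ (-(1 / 2) : ℝ)) * (weight N n u * weight N n' u') := by
  by_cases ht : N ≤ freeCount N r n u + freeCount N r n' u'
  · refine (infinitePi_position_eq_le hd n n' hn hn' u u').trans
      ((ofReal_rpow_le hN ht (Real.sqrt_nonneg _)).trans ?_)
    gcongr
    · exact decay_sq_le_weight hN ht (Nat.le_add_right _ _)
    · exact decay_sq_le_weight hN ht (Nat.le_add_left _ _)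
  -- With fewer than `N` free edges in total, a meeting is almost surely impossible.
  · refine le_trans (le_of_eq ?_) zero_le
    refine measure_eq_zero_iff_ae_notMem.2 ?_
    filter_upwards [ae_coreStep] with X hX h
    exact ht (le_freeCount_add_freeCount hab hX.1 hX.2 hn hn' hu hu' h).2

lemma measure_not_isPivotal_le (hd : 10 < d) (hab : a ≠ b) (hN : 1 ≤ N) :
    ((Measure.infinitePi (coreOffspring hp N r)).prod (Measure.infinitePi (coreStep N r a b)))
      {ω | ¬ IsPivotal ω 0} ≤
      ENNReal.ofReal (√(d ^ d) * (N : ℝ) ^ (-(1 / 2) : ℝ)) *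
        (∑' v : Label ℤ, reach (coreOffspring hp N r) v.1 v.2 * weight N v.1 v.2) ^ 2 := by
  set q : Label ℤ → ENNReal := fun v => reach (coreOffspring hp N r) v.1 v.2
  set C := ENNReal.ofReal (√(d ^ d) * (N : ℝ) ^ (-(1 / 2) : ℝ))
  have hsub : {ω : Sample d | ¬ IsPivotal ω 0} ⊆ ⋃ v : Label ℤ, ⋃ w : Label ℤ,
      {ξ | (v.1 ≤ 0 ∧ 1 ≤ w.1) ∧ (InTree ξ v.1 v.2 ∧ InTree ξ w.1 w.2)} ×ˢ
        {X | position X v.1 v.2 = position X w.1 w.2} := by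
    intro ω hω
    obtain ⟨v, w, h1, h2, h3, h4⟩ := exists_of_not_isPivotal hω
    exact Set.mem_iUnion.2 ⟨v, Set.mem_iUnion.2 ⟨w, ⟨⟨h1, h2⟩, h3⟩, h4⟩⟩
  have hpair : ∀ v w : Label ℤ,
      ((Measure.infinitePi (coreOffspring hp N r)).prod (Measure.infinitePi (coreStep N r a b)))
      ({ξ | (v.1 ≤ 0 ∧ 1 ≤ w.1) ∧ (InTree ξ v.1 v.2 ∧ InTree ξ w.1 w.2)} ×ˢ
        {X | position X v.1 v.2 = position X w.1 w.2}) ≤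
      C * (q v * weight N v.1 v.2) * (q w * weight N w.1 w.2) := by
    intro v w
    rw [Measure.prod_prod]
    by_cases hvw : v.1 ≤ 0 ∧ 1 ≤ w.1
    · simp only [hvw, true_and, and_self]
      rw [infinitePi_inTree_and_inTree _ (by omega)]
      -- Pairs with a vanishing factor are trivial; for the others, nonzero reach puts any vertex
      -- over a core index into the core, as the geometric estimate requires.
      by_cases hv : q v = 0
      · simp [q] at hv
        simp [hv]
      by_cases hw : q w = 0
      · simp [q] at hw
        simp [hw]
      calc _ ≤ q v * q w * (C * (weight N v.1 v.2 * weight N w.1 w.2)) := by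
            gcongr
            exact infinitePi_position_eq_le_weight hd hab hN hvw.1 hvw.2
              (fun h => mem_core_of_reach_ne_zero h hv) (fun h => mem_core_of_reach_ne_zero h hw)
        _ = _ := by ring
    · simp [hvw]
  calc _ ≤ _ := measure_mono hsub
    _ ≤ ∑' v : Label ℤ, ∑' w : Label ℤ, C * (q v * weight N v.1 v.2) *
          (q w * weight N w.1 w.2) := by
        refine (measure_iUnion_le _).trans (ENNReal.tsum_le_tsum fun v => ?_)
        exact (measure_iUnion_le _).trans (ENNReal.tsum_le_tsum fun w => hpair v w)
    _ = _ := by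
        simp_rw [ENNReal.tsum_mul_left, ENNReal.tsum_mul_right, ENNReal.tsum_mul_left]
        ring

lemma prod_coreOffspring_coreStep_absolutelyContinuous (h0 : p 0 ≠ 0)
    (hr : offspringLaw p hp [] r ≠ 0) :
    ((Measure.infinitePi (coreOffspring hp N r)).prod (Measure.infinitePi (coreStep N r a b))) ≪
      ibicbrw p hp d := by
  rw [ibicbrw, ibicgw_eq_infinitePi, jumpLaw]
  refine Measure.AbsolutelyContinuous.prod
    (infinitePi_pinned_absolutelyContinuous _ _ _ ?_)
    (infinitePi_pinned_absolutelyContinuous _ _ _ ?_)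
  · rintro ⟨n, u⟩ hv
    rw [PMF.toMeasure_apply_singleton _ _ (measurableSet_singleton _)]
    rcases (mem_core.1 hv).2 with rfl | ⟨j, -, rfl⟩
    · simpa using hr
    · simpa [offspringLaw] using h0
  · intro v _
    have : ∃ s, coreJump a b v = unitVector d s := by
      rcases v with ⟨n, _ | ⟨j, u⟩⟩ <;> exact ⟨_, rfl⟩
    obtain ⟨s, hs⟩ := this
    rw [PMF.toMeasure_apply_singleton _ _ (measurableSet_singleton _), hs, ← PMF.mem_support_iff,
      srwStep, PMF.mem_support_map_iff]
    exact ⟨s, by simp, rfl⟩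

end Laws

end CriticalBRW

/-! ### Choice of the parameters and conclusion. -/

theorem lemma4p2 (d : ℕ) [NeZero d] (hd : 10 < d) (p : PMF ℕ)
    (hp : CriticalBRW.IsCritical p) (hne : p ≠ PMF.pure 1)
    (h2 : CriticalBRW.HasFiniteSecondMoment p) :
    0 < CriticalBRW.ibicbrw p hp d {ω | CriticalBRW.IsPivotal ω 0} := by
  open CriticalBRW in
  obtain ⟨r, hr⟩ := (offspringLaw p hp []).support_nonempty
  rw [PMF.mem_support_iff] at hr
  let a : Fin d := ⟨0, by omega⟩
  let b : Fin d := ⟨1, by omega⟩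
  have hab : a ≠ b := by simp [a, b]
  set σ := ∑' k : ℕ, (k : ENNReal) ^ 2 * p k
  set K : ENNReal := 3 * (1 + r) + 2 * (∑' k, decay k) * ((1 + σ) * ∑' k, decay k)
  have hKt : K ≠ ⊤ := by
    have hs : σ ≠ ⊤ := h2.ne
    have hw := tsum_decay_ne_top
    finiteness
  -- `r`, and with it `K`, is fixed before `N`, so the factor N^(-1/2) eventually wins.
  have hlim : Filter.Tendsto (fun N : ℕ => √(d ^ d : ℝ) * (N : ℝ) ^ (-(1 / 2) : ℝ) * K.toReal ^ 2)
      Filter.atTop (nhds 0) := by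
    have h := (tendsto_rpow_neg_atTop (show (0 : ℝ) < 1 / 2 by norm_num)).comp
      tendsto_natCast_atTop_atTop
    simpa [Function.comp_def] using (h.const_mul √(d ^ d : ℝ)).mul_const (K.toReal ^ 2)
  obtain ⟨N, hN, hN1⟩ := ((hlim.eventually (gt_mem_nhds one_pos)).and
    (Filter.eventually_ge_atTop 1)).exists
  set P := (Measure.infinitePi (coreOffspring hp N r)).prod (Measure.infinitePi (coreStep N r a b))
  have hbad : P {ω | ¬ IsPivotal ω 0} < 1 := by
    refine (measure_not_isPivotal_le hd hab hN1).trans_lt ?_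
    calc _ ≤ ENNReal.ofReal (√(d ^ d) * (N : ℝ) ^ (-(1 / 2) : ℝ)) * K ^ 2 := by
          gcongr
          exact tsum_reach_mul_weight_le le_rfl hN1
      _ = ENNReal.ofReal (√(d ^ d) * (N : ℝ) ^ (-(1 / 2) : ℝ) * K.toReal ^ 2) := by
          rw [ENNReal.ofReal_mul (p := √(d ^ d) * _) (by positivity), ENNReal.ofReal_pow ENNReal.toReal_nonneg,
            ENNReal.ofReal_toReal hKt]
      _ < 1 := by rwa [ENNReal.ofReal_lt_one]
  -- If pivotality were null for the original law, absolute continuity would make it null under `P`,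
  -- and its complement would have full mass.
  refine pos_iff_ne_zero.2 fun hzero => hbad.not_ge ?_
  have hP := prod_coreOffspring_coreStep_absolutelyContinuous (N := N) (a := a) (b := b)
    (apply_zero_ne_zero hp hne) hr hzero
  calc (1 : ENNReal) = P Set.univ := measure_univ.symm
    _ ≤ P ({ω | IsPivotal ω 0} ∪ {ω | ¬ IsPivotal ω 0}) :=
        measure_mono fun ω _ => em (IsPivotal ω 0)
    _ ≤ P {ω | IsPivotal ω 0} + P {ω | ¬ IsPivotal ω 0} := measure_union_le _ _
    _ = _ := by rw [hP, zero_add]
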